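/- Let $PSL(2,\mathbb{R})=SL(2,\mathbb{R})/\{\pm\mathrm{Id}\}$ act by Möbius transformations on $\partial\mathbb{H}=\mathbb{R}\cup\{\infty\}$ (the one-point compactification of $\mathbb{R}$), and let $U$ and $B$ be the subgroups of $PSL(2,\mathbb{R})$ consisting of the classes of the matrices $\begin{pmatrix}1&t\\0&1\end{pmatrix}$ ($t\in\mathbb{R}$) and $\begin{pmatrix}\lambda&t\\0&\lambda^{-1}\end{pmatrix}$ ($t\in\mathbb{R}$, $\lambda>0$), respectively. Let $\Gamma$ be a torsion-free discrete subgroup of $PSL(2,\mathbb{R})$ such that $\Gamma\backslash PSL(2,\mathbb{R})$ is compact. Let $\Gamma$ act on $PSL(2,\mathbb{R})\times\partial\mathbb{H}$ by $\gamma(f,\xi)=(\gamma f,\gamma(\xi))$, and let $X=\Gamma\backslash(PSL(2,\mathbb{R})\times\partial\mathbb{H})$ be the quotient space, on which $PSL(2,\mathbb{R})$ acts on the right by $\Gamma(f,\xi)f'=\Gamma(ff',\xi)$. For a subgroup $F$ of $PSL(2,\mathbb{R})$, a non-empty $F$-minimal subset of $X$ is a subset that is minimal for inclusion among the non-empty closed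 $F$-invariant subsets of $X$. Put $$\mathcal{M}=\Big\{\,\Gamma\Big(\pm\begin{pmatrix}a&b\\c&d\end{pmatrix},\frac ac\Big)\ :\ a,b,c,d\in\mathbb{R},\ ad-bc=1\Big\}\subset X,$$ where $\frac ac=\infty$ if $c=0$. Then $\mathcal{M}$ is the unique non-empty $B$-minimal subset of $X$, and $\mathcal{M}$ is also the unique non-empty $U$-minimal subset of $X$. -/

import Mathlib

open scoped MatrixGroups

noncomputable section

namespace Horocycle

/-- The matrix `[a, b; c, d]` of determinant one, as an element of `SL(2, ℝ)`. -/
def sl (a b c d : ℝ) (h : a * d - b * c = 1) : SL(2, ℝ) :=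
  ⟨!![a, b; c, d], by rw [Matrix.det_fin_two_of, h]⟩

/-- The class `± [a, b; c, d]` in `PSL(2, ℝ)` of a real matrix of determinant one. -/
def pm (a b c d : ℝ) (h : a * d - b * c = 1) : PSL(2, ℝ) :=
  QuotientGroup.mk (sl a b c d h)

lemma pm_mul (a b c d a' b' c' d' : ℝ) (h : a * d - b * c = 1) (h' : a' * d' - b' * c' = 1) :
    pm a b c d h * pm a' b' c' d' h' =
      pm (a * a' + b * c') (a * b' + b * d') (c * a' + d * c') (c * b' + d * d')
        (by linear_combination (a' * d' - b' * c') * h + h') := by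
  unfold pm
  rw [← QuotientGroup.mk_mul]
  refine congrArg QuotientGroup.mk (Subtype.ext ?_)
  exact Matrix.mul_fin_two a b c d a' b' c' d'

lemma pm_one : pm 1 0 0 1 (by norm_num) = 1 :=
  congrArg QuotientGroup.mk (Subtype.ext Matrix.one_fin_two.symm)

lemma pm_inv (a b c d : ℝ) (h : a * d - b * c = 1) :
    (pm a b c d h)⁻¹ = pm d (-b) (-c) a (by linear_combination h) := by
  rw [inv_eq_iff_mul_eq_one, pm_mul, ← pm_one]
  congr 1
  · linear_combination h
  · ring
  · ring
  · linear_combination h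

/-- The boundary `∂ℍ = ℝ ∪ {∞}` of the half-plane: the one-point compactification of `ℝ`. -/
abbrev Bdry : Type := OnePoint ℝ

/-- The action of `PSL(2, ℝ)` on `∂ℍ = ℝ ∪ {∞}` by Möbius transformations, obtained from the
projective action under `t ↦ [t : 1]`, `∞ ↦ [1 : 0]`. -/
instance bdryAction : MulAction PSL(2, ℝ) Bdry :=
  (OnePoint.equivProjectivization ℝ).mulAction PSL(2, ℝ)

/-- The boundary point `a / c`, with the convention `a / 0 = ∞`. -/
def ratio (a c : ℝ) : Bdry := if c = 0 then OnePoint.infty else ((a / c : ℝ) : OnePoint ℝ)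

lemma pm_smul_infty (a b c d : ℝ) (h : a * d - b * c = 1) :
    pm a b c d h • (OnePoint.infty : Bdry) = ratio a c := by
  have key : pm a b c d h • (OnePoint.infty : Bdry) =
      (sl a b c d h : GL (Fin 2) ℝ) • (OnePoint.infty : OnePoint ℝ) := rfl
  rw [key, OnePoint.smul_infty_eq_ite]
  rfl

lemma pm_smul_coe (a b c d : ℝ) (h : a * d - b * c = 1) (t : ℝ) :
    pm a b c d h • ((t : OnePoint ℝ) : Bdry) = ratio (a * t + b) (c * t + d) := by
  have key : pm a b c d h • ((t : OnePoint ℝ) : Bdry) =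
      (sl a b c d h : GL (Fin 2) ℝ) • (t : OnePoint ℝ) := rfl
  rw [key, OnePoint.smul_some_eq_ite]
  rfl

/-- The subgroup `U` of the classes of the matrices `[1, t; 0, 1]`. -/
def U : Subgroup PSL(2, ℝ) where
  carrier := {f | ∃ t : ℝ, f = pm 1 t 0 1 (by ring)}
  mul_mem' := by
    rintro _ _ ⟨t, rfl⟩ ⟨s, rfl⟩
    exact ⟨s + t, by rw [pm_mul]; congr 1 <;> ring⟩
  one_mem' := ⟨0, pm_one.symm⟩
  inv_mem' := by
    rintro _ ⟨t, rfl⟩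
    exact ⟨-t, by rw [pm_inv]; congr 1; ring⟩

/-- The subgroup `B` of the classes of the matrices `[l, t; 0, l⁻¹]` with `l > 0`. -/
def B : Subgroup PSL(2, ℝ) where
  carrier := {f | ∃ (t l : ℝ) (hl : 0 < l), f = pm l t 0 l⁻¹ (by field_simp; ring)}
  mul_mem' := by
    rintro _ _ ⟨t, l, hl, rfl⟩ ⟨s, m, hm, rfl⟩
    exact ⟨l * s + t * m⁻¹, l * m, mul_pos hl hm, by rw [pm_mul]; congr 1 <;> simp [mul_comm]⟩
  one_mem' := ⟨0, 1, one_pos, by rw [← pm_one]; congr 1; simp⟩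
  inv_mem' := by
    rintro _ ⟨t, l, hl, rfl⟩
    exact ⟨-t, l⁻¹, inv_pos.2 hl, by rw [pm_inv]; congr 1 <;> simp⟩

/-- `X = Γ \ (PSL(2, ℝ) × ∂ℍ)`, the quotient by the diagonal action `γ (f, ξ) = (γ f, γ ξ)`,
with the quotient topology. -/
abbrev X (Γ : Subgroup PSL(2, ℝ)) : Type :=
  Quotient (MulAction.orbitRel Γ (PSL(2, ℝ) × Bdry))

/-- The class `Γ (f, ξ)` in `X`. -/
def toX (Γ : Subgroup PSL(2, ℝ)) (f : PSL(2, ℝ)) (ξ : Bdry) : X Γ :=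
  Quotient.mk (MulAction.orbitRel Γ (PSL(2, ℝ) × Bdry)) (f, ξ)

/-- The right action on `X`: `Γ (f, ξ) f' = Γ (f f', ξ)`. -/
def rightMul (Γ : Subgroup PSL(2, ℝ)) (x : X Γ) (f' : PSL(2, ℝ)) : X Γ :=
  Quotient.map (fun p : PSL(2, ℝ) × Bdry => (p.1 * f', p.2))
    (by
      rintro _ p ⟨γ, rfl⟩
      exact ⟨γ, Prod.ext (by simp [Subgroup.smul_def, mul_assoc]) rfl⟩) x

lemma rightMul_toX (Γ : Subgroup PSL(2, ℝ)) (f f' : PSL(2, ℝ)) (ξ : Bdry) :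
    rightMul Γ (toX Γ f ξ) f' = toX Γ (f * f') ξ := rfl

/-- `S` is a (non-empty) `F`-minimal subset of `X`: it is minimal for inclusion among the
non-empty closed subsets that are invariant under the right action of `F`. -/
def IsMinimalSet (Γ F : Subgroup PSL(2, ℝ)) (S : Set (X Γ)) : Prop :=
  Minimal (fun T : Set (X Γ) =>
    T.Nonempty ∧ IsClosed T ∧ ∀ x ∈ T, ∀ f ∈ F, rightMul Γ x f ∈ T) S

/-- The set `𝓜` of all the classes `Γ (± [a, b; c, d], a / c)`. -/
def M (Γ : Subgroup PSL(2, ℝ)) : Set (X Γ) :=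
  {x | ∃ (a b c d : ℝ) (h : a * d - b * c = 1), x = toX Γ (pm a b c d h) (ratio a c)}

end Horocycle

end

noncomputable section

namespace Horocycle

open Filter Topology

/-! `M Γ` is the image of the graph of `f ↦ f • ∞`, and `B` fixes `∞`, so `f ↦ Γ(f, f • ∞)`
intertwines right translation by `B` with its action on `M Γ`. It suffices that every non-empty
closed `U`-invariant `T` contains `M Γ` (`M_subset`): then `M Γ` is the least such set, for `U` and
for `B`.

First, `T` meets `M Γ` (`exists_toX_mem`): moving `Γ(A, A • η)` by `uni n` gives `Γ(A * uni n, (A *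
uni n) • (η - n))`, and `η - n → ∞` while cocompactness supplies a limit of the first component.
Next, the pullback of `T` to `SL(2, ℝ)` is everything by Hedlund's theorem
(`IsUniform.horo_eq_univ`).

For Hedlund's theorem, take a minimal `Y`. It accumulates on itself outside `U`-orbits
(`exists_frequently`), which forces invariance under the diagonal flow (`dia_invariant`). It is not
contained in one coset of the upper triangular group (`exists_transverse`). Expansion along the flow
then makes it dense. -/

/-! ### Entrywise computations in `SL(2, ℝ)`; unipotent and diagonal one-parameter groups. -/

lemma sl2_ext {A B : SL(2, ℝ)} (h00 : A 0 0 = B 0 0) (h01 : A 0 1 = B 0 1)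
    (h10 : A 1 0 = B 1 0) (h11 : A 1 1 = B 1 1) : A = B := by
  ext i j
  fin_cases i <;> fin_cases j <;> assumption

lemma sl2_det (A : SL(2, ℝ)) : A 0 0 * A 1 1 - A 0 1 * A 1 0 = 1 := by
  rw [← Matrix.det_fin_two, A.det_coe]

lemma sl2_mul (A B : SL(2, ℝ)) (i j : Fin 2) : (A * B) i j = A i 0 * B 0 j + A i 1 * B 1 j := by
  simp [Matrix.mul_apply, Fin.sum_univ_two]

lemma sl2_inv00 (A : SL(2, ℝ)) : A⁻¹ 0 0 = A 1 1 := by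
  simp [Matrix.SpecialLinearGroup.coe_inv, Matrix.adjugate_fin_two]

lemma sl2_inv01 (A : SL(2, ℝ)) : A⁻¹ 0 1 = -A 0 1 := by
  simp [Matrix.SpecialLinearGroup.coe_inv, Matrix.adjugate_fin_two]

lemma sl2_inv10 (A : SL(2, ℝ)) : A⁻¹ 1 0 = -A 1 0 := by
  simp [Matrix.SpecialLinearGroup.coe_inv, Matrix.adjugate_fin_two]

lemma sl2_inv11 (A : SL(2, ℝ)) : A⁻¹ 1 1 = A 0 0 := by
  simp [Matrix.SpecialLinearGroup.coe_inv, Matrix.adjugate_fin_two]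

lemma continuous_entry (i j : Fin 2) : Continuous fun A : SL(2, ℝ) => A i j := by
  have h : Continuous fun A : SL(2, ℝ) => (A : Matrix (Fin 2) (Fin 2) ℝ) := continuous_subtype_val
  exact h.matrix_elem i j

lemma tendsto_sl2 {ι : Type*} {F : Filter ι} {f : ι → SL(2, ℝ)} {A : SL(2, ℝ)}
    (h00 : Tendsto (fun i => f i 0 0) F (𝓝 (A 0 0))) (h01 : Tendsto (fun i => f i 0 1) F (𝓝 (A 0 1)))
    (h10 : Tendsto (fun i => f i 1 0) F (𝓝 (A 1 0)))
    (h11 : Tendsto (fun i => f i 1 1) F (𝓝 (A 1 1))) : Tendsto f F (𝓝 A) := by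
  refine tendsto_subtype_rng.2 (tendsto_pi_nhds.2 fun i => tendsto_pi_nhds.2 fun j => ?_)
  fin_cases i <;> fin_cases j <;> assumption

@[simp] lemma sl_00 (a b c d : ℝ) (h : a * d - b * c = 1) : sl a b c d h 0 0 = a := rfl
@[simp] lemma sl_01 (a b c d : ℝ) (h : a * d - b * c = 1) : sl a b c d h 0 1 = b := rfl
@[simp] lemma sl_10 (a b c d : ℝ) (h : a * d - b * c = 1) : sl a b c d h 1 0 = c := rfl
@[simp] lemma sl_11 (a b c d : ℝ) (h : a * d - b * c = 1) : sl a b c d h 1 1 = d := rfl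

lemma one_00 : (1 : SL(2, ℝ)) 0 0 = 1 := by simp
lemma one_01 : (1 : SL(2, ℝ)) 0 1 = 0 := by simp
lemma one_10 : (1 : SL(2, ℝ)) 1 0 = 0 := by simp
lemma one_11 : (1 : SL(2, ℝ)) 1 1 = 1 := by simp

/-- The unipotent matrix `[1, t; 0, 1]`. -/
def uni (t : ℝ) : SL(2, ℝ) := sl 1 t 0 1 (by ring)

/-- The diagonal matrix `[exp s, 0; 0, exp (-s)]`. -/
def dia (s : ℝ) : SL(2, ℝ) :=
  sl (Real.exp s) 0 0 (Real.exp (-s)) (by rw [← Real.exp_add]; simp)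

lemma uni_zero : uni 0 = 1 := by
  apply sl2_ext <;> simp [uni]

lemma uni_mul (s t : ℝ) : uni s * uni t = uni (s + t) := by
  apply sl2_ext <;> simp [uni, sl2_mul, -Matrix.SpecialLinearGroup.coe_mul, add_comm]

lemma uni_inv (t : ℝ) : (uni t)⁻¹ = uni (-t) := by
  rw [inv_eq_iff_mul_eq_one, uni_mul, add_neg_cancel, uni_zero]

lemma dia_zero : dia 0 = 1 := by
  apply sl2_ext <;> simp [dia]

lemma dia_mul (s t : ℝ) : dia s * dia t = dia (s + t) := by
  apply sl2_ext <;> simp [dia, sl2_mul, -Matrix.SpecialLinearGroup.coe_mul, Real.exp_add, mul_comm]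

lemma dia_inv (t : ℝ) : (dia t)⁻¹ = dia (-t) := by
  rw [inv_eq_iff_mul_eq_one, dia_mul, add_neg_cancel, dia_zero]

/-- The diagonal group normalizes the unipotent one, and conjugation contracts `uni t` as `s → ∞`.
-/
lemma uni_mul_dia (t s : ℝ) : uni t * dia s = dia s * uni (Real.exp (-s) * Real.exp (-s) * t) := by
  apply sl2_ext <;> simp [dia, uni, sl2_mul, -Matrix.SpecialLinearGroup.coe_mul]
  rw [← mul_assoc, ← mul_assoc, ← Real.exp_add]
  simp [mul_comm]

lemma continuous_uni : Continuous uni :=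
  continuous_iff_continuousAt.2 fun t => by
    apply tendsto_sl2 <;> simp only [uni, sl_00, sl_01, sl_10, sl_11]
    exacts [tendsto_const_nhds, tendsto_id, tendsto_const_nhds, tendsto_const_nhds]

lemma continuous_dia : Continuous dia :=
  continuous_iff_continuousAt.2 fun t => by
    apply tendsto_sl2 <;> simp only [dia, sl_00, sl_01, sl_10, sl_11]
    exacts [Real.continuous_exp.continuousAt, tendsto_const_nhds, tendsto_const_nhds,
      (Real.continuous_exp.comp continuous_neg).continuousAt]

/-! ### Cocompact discrete groups and minimal horocycle-invariant sets. -/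

/-- `Γ` is a discrete subgroup of `SL(2, ℝ)` and the compact set `K` meets each of its orbits. -/
structure IsUniform (Γ : Subgroup SL(2, ℝ)) (K : Set SL(2, ℝ)) : Prop where
  compact : IsCompact K
  cover : ∀ g, ∃ γ ∈ Γ, γ * g ∈ K
  isolated : ∀ᶠ g in 𝓝 (1 : SL(2, ℝ)), g ∈ Γ → g = 1

/-- `T` is a non-empty closed set, invariant under `Γ` on the left and under all `uni t` on the
right. -/
structure IsHoro (Γ : Subgroup SL(2, ℝ)) (T : Set SL(2, ℝ)) : Prop where
  nonempty : T.Nonempty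
  closed : IsClosed T
  left : ∀ γ ∈ Γ, ∀ g ∈ T, γ * g ∈ T
  right : ∀ g ∈ T, ∀ t, g * uni t ∈ T

variable {Γ : Subgroup SL(2, ℝ)} {K : Set SL(2, ℝ)}

/-- Cocompactness in the form used throughout; an ultrafilter avoids extracting subsequences. -/
lemma IsUniform.exists_tendsto (h : IsUniform Γ K) {ι : Type*} (𝒰 : Ultrafilter ι)
    (g : ι → SL(2, ℝ)) :
    ∃ γ : ι → SL(2, ℝ), (∀ i, γ i ∈ Γ) ∧ ∃ k, Tendsto (fun i => γ i * g i) 𝒰 (𝓝 k) := by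
  choose γ hγ hK using fun i => h.cover (g i)
  obtain ⟨k, -, hk⟩ := h.compact.ultrafilter_le_nhds (𝒰.map fun i => γ i * g i)
    (le_principal_iff.2 (Ultrafilter.mem_map.2 (Eventually.of_forall hK)))
  exact ⟨γ, hγ, k, hk⟩

/-- A cocompact discrete group has no nontrivial unipotents. With `δ n * g * dia n → k`, the
conjugates `δ n * γ * (δ n)⁻¹` tend to `k * 1 * k⁻¹ = 1`, so discreteness makes one of them trivial.
-/
lemma IsUniform.eq_zero_of_unipotent (h : IsUniform Γ K) {γ g : SL(2, ℝ)} {t : ℝ} (hγ : γ ∈ Γ)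
    (e : γ * g = g * uni t) : t = 0 := by
  obtain ⟨δ, hδ, k, hk⟩ := h.exists_tendsto (hyperfilter ℕ) fun n => g * dia n
  have hn : Tendsto (fun n : ℕ => Real.exp (-(n : ℝ)) * Real.exp (-(n : ℝ)) * t)
      (hyperfilter ℕ : Filter ℕ) (𝓝 0) := by
    have h0 : Tendsto (fun n : ℕ => Real.exp (-(n : ℝ))) (hyperfilter ℕ : Filter ℕ) (𝓝 0) :=
      (Real.tendsto_exp_neg_atTop_nhds_zero.comp tendsto_natCast_atTop_atTop).mono_left
        Nat.hyperfilter_le_atTop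
    simpa using (h0.mul h0).mul_const t
  have hlim := (hk.mul ((continuous_uni.tendsto 0).comp hn)).mul hk.inv
  rw [uni_zero, mul_one, mul_inv_cancel] at hlim
  have hconj : ∀ n : ℕ, δ n * (g * dia n) * (uni (Real.exp (-(n : ℝ)) * Real.exp (-(n : ℝ)) * t)) *
      (δ n * (g * dia n))⁻¹ = δ n * γ * (δ n)⁻¹ := by
    intro n
    rw [eq_mul_inv_of_mul_eq e]
    rw [eq_inv_mul_of_mul_eq (uni_mul_dia t n).symm]
    group
  obtain ⟨n, hn⟩ := (hlim.eventually h.isolated).exists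
  simp only [Function.comp, hconj] at hn
  have h1 := hn (Γ.mul_mem (Γ.mul_mem (hδ n) hγ) (Γ.inv_mem (hδ n)))
  have h2 : γ = 1 := by simpa using h1
  have h3 : uni t = 1 := by simpa [h2] using e.symm
  simpa [uni] using congrArg (fun A : SL(2, ℝ) => A 0 1) h3

/-- Zorn's lemma: each set meets the compact `K` by left `Γ`-invariance, so chains have non-empty
intersection. -/
lemma IsHoro.exists_minimal (h : IsUniform Γ K) {T : Set SL(2, ℝ)} (hT : IsHoro Γ T) :
    ∃ Y ⊆ T, Minimal (fun S => IsHoro Γ S) Y := by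
  refine zorn_superset_nonempty {S | IsHoro Γ S} (fun c hc hchain hne => ?_) T hT
  refine ⟨⋂₀ c, ⟨?_, isClosed_sInter fun s hs => (hc hs).closed, ?_, ?_⟩,
    fun s hs => Set.sInter_subset_of_mem hs⟩
  · have : Nonempty ((fun s => s ∩ K) '' c) := (hne.image _).to_subtype
    have hI := IsCompact.nonempty_sInter_of_directed_nonempty_isCompact_isClosed
      (S := (fun s => s ∩ K) '' c) ?_ ?_ ?_ ?_
    · obtain ⟨x, hx⟩ := hI
      exact ⟨x, fun s hs => (hx _ ⟨s, hs, rfl⟩).1⟩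
    · rintro _ ⟨s, hs, rfl⟩ _ ⟨t, ht, rfl⟩
      rcases hchain.total hs ht with h | h
      · exact ⟨_, ⟨s, hs, rfl⟩, subset_rfl, Set.inter_subset_inter_left _ h⟩
      · exact ⟨_, ⟨t, ht, rfl⟩, Set.inter_subset_inter_left _ h, subset_rfl⟩
    · rintro _ ⟨s, hs, rfl⟩
      obtain ⟨g, hg⟩ := (hc hs).nonempty
      obtain ⟨γ, hγ, hK⟩ := h.cover g
      exact ⟨_, (hc hs).left γ hγ g hg, hK⟩
    · rintro _ ⟨s, hs, rfl⟩
      exact h.compact.inter_left (hc hs).closed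
    · rintro _ ⟨s, hs, rfl⟩
      exact (hc hs).closed.inter h.compact.isClosed
  · exact fun γ hγ g hg s hs => (hc hs).left γ hγ g (hg s hs)
  · exact fun g hg t s hs => (hc hs).right g (hg s hs) t

/-- Otherwise `Y` lies near `y` in the single orbit `y U`, and minimality gives `Y ⊆ Γ y U`.
Recurrence of `y U` then produces either a unipotent in `Γ` or a convergent sequence `uni n`, and
both are impossible. -/
lemma IsUniform.exists_frequently (h : IsUniform Γ K) {Y : Set SL(2, ℝ)}
    (hY : Minimal (fun S => IsHoro Γ S) Y) {y : SL(2, ℝ)} (hy : y ∈ Y) :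
    ∃ᶠ g in 𝓝 (1 : SL(2, ℝ)), y * g ∈ Y ∧ ∀ t, g ≠ uni t := by
  intro hN
  have hN' : ∀ᶠ g in 𝓝 (1 : SL(2, ℝ)), y * g ∈ Y → ∃ t, g = uni t :=
    hN.mono fun g hg hgY => by simpa using fun h => hg ⟨hgY, h⟩
  obtain ⟨N, hN, hNo, h1⟩ := eventually_nhds_iff.1 hN'
  have hYprop := hY.prop
  -- the part of `Y` outside the open set `Γ y N U` is empty by minimality
  let O : Set SL(2, ℝ) := ⋃ γ : Γ, ⋃ t : ℝ, (fun g => y⁻¹ * ((γ : SL(2, ℝ)) * g * uni t)) ⁻¹' N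
  have hO : IsOpen O := isOpen_iUnion fun γ => isOpen_iUnion fun t => hNo.preimage (by fun_prop)
  have hcover : ∀ z ∈ Y, ∃ γ ∈ Γ, ∃ t, γ * z = y * uni t := by
    by_contra! hcon
    obtain ⟨z, hz, hzO⟩ := hcon
    have hdiff : IsHoro Γ (Y \ O) := by
      refine ⟨⟨z, hz, fun hzO' => ?_⟩, hYprop.closed.sdiff hO, ?_, ?_⟩
      · obtain ⟨γ, t, hg⟩ := by simpa [O, -Subtype.exists] using hzO'
        obtain ⟨s, hs⟩ := hN _ hg (by
          simpa using hYprop.right _ (hYprop.left _ γ.2 _ hz) t)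
        refine hzO γ γ.2 (s - t) ?_
        rw [inv_mul_eq_iff_eq_mul] at hs
        rw [eq_mul_inv_of_mul_eq hs, mul_assoc, uni_inv, uni_mul, sub_eq_add_neg]
      · rintro γ hγ g ⟨hgY, hgO⟩
        refine ⟨hYprop.left γ hγ g hgY, fun hO' => hgO ?_⟩
        simp only [O, Set.mem_iUnion, Set.mem_preimage] at hO' ⊢
        obtain ⟨δ, t, hg⟩ := hO'
        exact ⟨δ * ⟨γ, hγ⟩, t, by simpa [mul_assoc] using hg⟩
      · rintro g ⟨hgY, hgO⟩ t
        refine ⟨hYprop.right g hgY t, fun hO' => hgO ?_⟩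
        simp only [O, Set.mem_iUnion, Set.mem_preimage] at hO' ⊢
        obtain ⟨δ, s, hg⟩ := hO'
        exact ⟨δ, t + s, by simpa [mul_assoc, ← uni_mul] using hg⟩
    refine (hY.le_of_le hdiff Set.sdiff_subset hy).2 ?_
    simp only [O, Set.mem_iUnion, Set.mem_preimage]
    exact ⟨1, 0, by simpa [uni_zero] using h1⟩
  -- The limit `k` lies in `Γ y U`, so translates of `y * uni n` return close to `y`, hence into `y
  -- U`.
  obtain ⟨γ, hγ, k, hk⟩ := h.exists_tendsto (hyperfilter ℕ) fun n => y * uni n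
  have hkY : k ∈ Y := hYprop.closed.mem_of_tendsto hk
    (Eventually.of_forall fun n => hYprop.left _ (hγ n) _ (hYprop.right _ hy _))
  obtain ⟨δ, hδ, s, hks⟩ := hcover k hkY
  have hlim : Tendsto (fun n => y⁻¹ * (δ * (γ n * (y * uni n)) * uni (-s)))
      (hyperfilter ℕ : Filter ℕ) (𝓝 1) := by
    have := ((hk.const_mul δ).mul_const (uni (-s))).const_mul y⁻¹
    rwa [hks, mul_assoc, uni_mul, add_neg_cancel, uni_zero, mul_one, inv_mul_cancel] at this
  have hconst : ∀ᶠ n in (hyperfilter ℕ : Filter ℕ), γ n = δ⁻¹ := by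
    filter_upwards [hlim.eventually (hNo.mem_nhds h1)] with n hn
    obtain ⟨r, hr⟩ := hN _ hn (by
      rw [mul_inv_cancel_left]
      exact hYprop.right _ (hYprop.left _ hδ _ (hYprop.left _ (hγ n) _ (hYprop.right _ hy _))) _)
    have e : δ * γ n * y = y * uni (r + s - n) := by
      rw [inv_mul_eq_iff_eq_mul] at hr
      rw [sub_eq_add_neg, ← uni_mul, ← uni_mul, ← mul_assoc, ← mul_assoc, ← hr]
      simp only [← uni_inv]
      group
    have h0 := h.eq_zero_of_unipotent (Γ.mul_mem hδ (hγ n)) e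
    rw [h0, uni_zero, mul_one, mul_eq_right] at e
    exact eq_inv_of_mul_eq_one_right e
  have hu : Tendsto (fun n : ℕ => uni n) (hyperfilter ℕ : Filter ℕ) (𝓝 (y⁻¹ * (δ * k))) := by
    refine ((hk.const_mul δ).const_mul y⁻¹).congr' ?_
    filter_upwards [hconst] with n hn
    rw [hn]
    group
  have h2 := ((continuous_entry 0 1).tendsto _).comp hu
  refine not_tendsto_nhds_of_tendsto_atTop ?_ _ h2
  exact tendsto_natCast_atTop_atTop.mono_left Nat.hyperfilter_le_atTop

/-- As `dia s` normalizes the unipotent group, the `z ∈ Y` with `z * dia s ∈ Y` form a set of the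
same kind, which is all of `Y` by minimality. -/
lemma IsHoro.mul_dia_mem {Y : Set SL(2, ℝ)} (hY : Minimal (fun S => IsHoro Γ S) Y)
    {y : SL(2, ℝ)} {s : ℝ} (hy : y ∈ Y) (hys : y * dia s ∈ Y) : ∀ z ∈ Y, z * dia s ∈ Y := by
  have hYprop := hY.prop
  have : IsHoro Γ (Y ∩ (fun z => z * dia s) ⁻¹' Y) := by
    refine ⟨⟨y, hy, hys⟩, hYprop.closed.inter (hYprop.closed.preimage (by fun_prop)), ?_, ?_⟩
    · rintro γ hγ g ⟨hg, hgs⟩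
      refine ⟨hYprop.left γ hγ g hg, ?_⟩
      simpa [mul_assoc] using hYprop.left γ hγ _ hgs
    · rintro g ⟨hg, hgs⟩ t
      refine ⟨hYprop.right g hg t, ?_⟩
      have := hYprop.right _ hgs (Real.exp (-s) * Real.exp (-s) * t)
      rwa [mul_assoc, ← uni_mul_dia, ← mul_assoc] at this
  exact fun z hz => (hY.le_of_le this Set.inter_subset_left hz).2

/-- A minimal horocycle-invariant set is invariant under the geodesic flow. -/
lemma IsUniform.dia_invariant (h : IsUniform Γ K) {Y : Set SL(2, ℝ)}
    (hY : Minimal (fun S => IsHoro Γ S) Y) (s : ℝ) : ∀ z ∈ Y, z * dia s ∈ Y := by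
  have hYprop := hY.prop
  obtain ⟨y, hy⟩ := hYprop.nonempty
  have := (frequently_mem_iff_neBot (s := {g | y * g ∈ Y ∧ ∀ t, g ≠ uni t})).1 (h.exists_frequently hY hy)
  obtain ⟨𝒰, h𝒰⟩ := Ultrafilter.exists_le
    (𝓝 (1 : SL(2, ℝ)) ⊓ 𝓟 {g | y * g ∈ Y ∧ ∀ t, g ≠ uni t})
  have hg : ∀ᶠ g in (𝒰 : Filter SL(2, ℝ)), y * g ∈ Y ∧ ∀ t, g ≠ uni t :=
    le_principal_iff.1 (h𝒰.trans inf_le_right)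
  have hid : Tendsto (fun g : SL(2, ℝ) => g) 𝒰 (𝓝 1) := h𝒰.trans inf_le_left
  have hent : ∀ i j, Tendsto (fun g : SL(2, ℝ) => g i j) 𝒰 (𝓝 ((1 : SL(2, ℝ)) i j)) :=
    fun i j => ((continuous_entry i j).tendsto 1).comp hid
  -- Along an ultrafilter exactly one case holds eventually: `g` upper triangular, or `g 1 0 ≠ 0`.
  rcases 𝒰.em fun g => g 1 0 = 0 with hc | hc
  · -- upper triangular elements generate a dense group of translations
    let S : AddSubgroup ℝ :=
      { carrier := {s | y * dia s ∈ Y}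
        zero_mem' := by simpa [dia_zero] using hy
        add_mem' := by
          intro a b ha hb
          have := IsHoro.mul_dia_mem hY hy hb _ ha
          rwa [mul_assoc, dia_mul] at this
        neg_mem' := by
          intro a ha
          refine IsHoro.mul_dia_mem hY ha ?_ _ hy
          rwa [mul_assoc, dia_mul, add_neg_cancel, dia_zero, mul_one] }
    have hS : Dense (S : Set ℝ) := by
      refine AddSubgroup.dense_of_not_isolated_zero S fun ε hε => ?_
      have h00 := hent 0 0
      rw [one_00] at h00
      have hlog : Tendsto (fun g : SL(2, ℝ) => Real.log (g 0 0)) 𝒰 (𝓝 0) := by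
        simpa using h00.log one_ne_zero
      obtain ⟨g, ⟨hgY, hgU⟩, hgc, hpos, hlt⟩ := (hg.and (hc.and ((h00.eventually_const_lt
        zero_lt_one).and (hlog.eventually (Metric.ball_mem_nhds 0 hε))))).exists
      have hdet := sl2_det g
      rw [hgc, mul_zero, sub_zero] at hdet
      have hdec : g = dia (Real.log (g 0 0)) * uni (g 0 1 * g 1 1) := by
        have hinv : g 1 1 = (g 0 0)⁻¹ := eq_inv_of_mul_eq_one_right hdet
        apply sl2_ext <;>
          simp [dia, uni, sl2_mul, -Matrix.SpecialLinearGroup.coe_mul, Real.exp_log hpos,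
            Real.exp_neg, hgc, hinv]
        field_simp
      have hmem : Real.log (g 0 0) ∈ S := by
        have := hYprop.right _ hgY (-(g 0 1 * g 1 1))
        rw [hdec, ← uni_inv, mul_assoc, mul_assoc] at this
        change y * dia (Real.log (g 0 0)) ∈ Y
        simpa [← hdec] using this
      have hne : Real.log (g 0 0) ≠ 0 := by
        intro h0
        rw [h0, dia_zero, one_mul] at hdec
        exact hgU _ hdec
      rw [Real.dist_0_eq_abs] at hlt
      rcases hne.lt_or_gt with hn | hn
      · exact ⟨_, S.neg_mem hmem, by simpa using hn, by rwa [abs_of_neg hn] at hlt⟩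
      · exact ⟨_, hmem, hn, by rwa [abs_of_pos hn] at hlt⟩
    have hcl : IsClosed (S : Set ℝ) :=
      hYprop.closed.preimage (continuous_const.mul continuous_dia)
    have : s ∈ (S : Set ℝ) := by
      rw [← hcl.closure_eq, hS.closure_eq]
      trivial
    exact IsHoro.mul_dia_mem hY hy this
  · let a := Real.exp s
    have ha : a ≠ 0 := (Real.exp_pos s).ne'
    -- Shearing: `t` makes the upper left entry of `uni (-t g) * g` equal to `a`, and `r` then kills
    -- the upper right entry. The product tends to `dia s` because `g 1 0 → 0`.
    let t : SL(2, ℝ) → ℝ := fun g => (g 0 0 - a) / g 1 0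
    let r : SL(2, ℝ) → ℝ := fun g => (t g * g 1 1 - g 0 1) / a
    obtain ⟨γ, hγ, k, hk⟩ := h.exists_tendsto 𝒰 fun g => y * uni (t g)
    have hkY : k ∈ Y := hYprop.closed.mem_of_tendsto hk
      (Eventually.of_forall fun n => hYprop.left _ (hγ n) _ (hYprop.right _ hy _))
    have hval : ∀ᶠ g in (𝒰 : Filter SL(2, ℝ)), uni (-t g) * g * uni (r g) =
        sl a 0 (g 1 0) a⁻¹ (by field_simp; ring) := by
      filter_upwards [hc] with g hgc
      have hdet := sl2_det g
      have ht : t g * g 1 0 = g 0 0 - a := div_mul_cancel₀ _ hgc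
      have hr : r g * a = t g * g 1 1 - g 0 1 := div_mul_cancel₀ _ ha
      apply sl2_ext <;>
        simp only [sl2_mul, uni, sl_00, sl_01, sl_10, sl_11]
      · linear_combination -ht
      · linear_combination hr - r g * ht
      · ring
      · apply mul_right_cancel₀ ha
        rw [inv_mul_cancel₀ ha]
        linear_combination hdet + g 1 0 * hr + g 1 1 * ht
    have hlim : Tendsto (fun g => uni (-t g) * g * uni (r g)) 𝒰 (𝓝 (dia s)) := by
      refine Tendsto.congr' (EventuallyEq.symm hval) ?_
      have h10 := hent 1 0
      rw [one_10] at h10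
      apply tendsto_sl2 <;> simp only [dia, sl_00, sl_01, sl_10, sl_11]
      exacts [tendsto_const_nhds, tendsto_const_nhds, h10,
        by rw [Real.exp_neg]; exact tendsto_const_nhds]
    refine IsHoro.mul_dia_mem hY hkY (hYprop.closed.mem_of_tendsto (hk.mul hlim) ?_)
    filter_upwards [hg] with g hgg
    have := hYprop.left _ (hγ g) _ (hYprop.right _ hgg.1 (r g))
    rw [← uni_inv]
    convert this using 1
    group

/-! ### Transversality to the upper triangular group, and Hedlund's theorem. -/

lemma inv_mul_eq_uni {A B : SL(2, ℝ)} (hA : A 1 0 = 0) (hB : B 1 0 = 0) (h0 : A 0 0 = B 0 0)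
    (h1 : A 1 1 = B 1 1) : A⁻¹ * B = uni (A 1 1 * B 0 1 - A 0 1 * B 1 1) := by
  have hdet := sl2_det A
  rw [hA, mul_zero, sub_zero] at hdet
  apply sl2_ext <;>
    simp only [sl2_mul, sl2_inv00, sl2_inv01, sl2_inv10, sl2_inv11, uni, sl_00, sl_01, sl_10,
      sl_11, hA, hB, ← h0, ← h1]
  · linear_combination hdet
  · ring
  · ring
  · linear_combination hdet

/-- Otherwise `y⁻¹ Γ y` is upper triangular. Its commutators are unipotent, hence trivial, so it is
abelian. But cocompactness along `dia` and `uni` yields an element with well separated diagonal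
entries and one with a huge off-diagonal entry, which cannot commute. -/
lemma IsUniform.exists_transverse (h : IsUniform Γ K) {Y : Set SL(2, ℝ)} (hY : IsHoro Γ Y)
    (hdia : ∀ s, ∀ z ∈ Y, z * dia s ∈ Y) : ∃ y₁ ∈ Y, ∃ y₂ ∈ Y, (y₁⁻¹ * y₂) 1 0 ≠ 0 := by
  by_contra! hcon
  obtain ⟨y, hy⟩ := hY.nonempty
  have hbound : ∀ i j, ∃ C, ∀ k ∈ K, |(y⁻¹ * k) i j| ≤ C := fun i j =>
    h.compact.exists_bound_of_continuousOn
      ((continuous_entry i j).comp (continuous_const_mul y⁻¹)).continuousOn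
  choose C hC using hbound
  obtain ⟨R, hR1, hR⟩ : ∃ R : ℝ, 1 ≤ R ∧ ∀ k ∈ K, |(y⁻¹ * k) 0 0| ≤ R ∧ |(y⁻¹ * k) 0 1| ≤ R ∧
      |(y⁻¹ * k) 1 1| ≤ R :=
    ⟨max 1 (max (C 0 0) (max (C 0 1) (C 1 1))), le_max_left _ _, fun k hk =>
      ⟨(hC 0 0 k hk).trans (by simp), (hC 0 1 k hk).trans (by simp),
        (hC 1 1 k hk).trans (by simp)⟩⟩
  -- every upper triangular `b` is a bounded upper triangular `q` up to `y⁻¹ Γ y`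
  have hred : ∀ b : SL(2, ℝ), y * b ∈ Y → ∃ γ ∈ Γ, ∃ q : SL(2, ℝ), y⁻¹ * γ * y = q * b⁻¹ ∧
      q 1 0 = 0 ∧ q 0 0 * q 1 1 = 1 ∧ |q 0 0| ≤ R ∧ |q 0 1| ≤ R ∧ |q 1 1| ≤ R := by
    intro b hb
    obtain ⟨γ, hγ, hK⟩ := h.cover (y * b)
    have h10 : (y⁻¹ * (γ * (y * b))) 1 0 = 0 := hcon y hy _ (hY.left γ hγ _ hb)
    refine ⟨γ, hγ, y⁻¹ * (γ * (y * b)), by group, h10, ?_, hR _ hK⟩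
    have := sl2_det (y⁻¹ * (γ * (y * b)))
    rwa [h10, mul_zero, sub_zero] at this
  have hcomm : ∀ γ ∈ Γ, ∀ δ ∈ Γ, Commute (y⁻¹ * γ * y) (y⁻¹ * δ * y) := by
    intro γ hγ δ hδ
    have hz : ∀ σ ∈ Γ, (y⁻¹ * σ * y) 1 0 = 0 := fun σ hσ => by
      rw [mul_assoc]
      exact hcon y hy _ (hY.left σ hσ y hy)
    have h1 := hz γ hγ
    have h2 := hz δ hδ
    set p := y⁻¹ * γ * y with hp
    set q := y⁻¹ * δ * y with hq
    have hu : (q * p)⁻¹ * (p * q) = uni _ := inv_mul_eq_uni (by simp only [sl2_mul, h1, h2]; ring)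
      (by simp only [sl2_mul, h1, h2]; ring) (by simp only [sl2_mul, h1, h2]; ring)
      (by simp only [sl2_mul, h1, h2]; ring)
    have h0 := h.eq_zero_of_unipotent (γ := (δ * γ)⁻¹ * (γ * δ)) (g := y)
      (Γ.mul_mem (Γ.inv_mem (Γ.mul_mem hδ hγ)) (Γ.mul_mem hγ hδ)) (by rw [← hu, hp, hq]; group)
    rw [h0, uni_zero, inv_mul_eq_one] at hu
    exact hu.symm
  -- The factor `2 * R` puts the diagonal entries at absolute value at most `1` and at least `2`.
  obtain ⟨γ₁, hγ₁, q, hq, hq10, hqdet, hq00, hq01, hq11⟩ := hred (dia (Real.log (2 * R)))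
    (hdia _ _ hy)
  have hR0 : 0 < R := by linarith
  let β := (q * (dia (Real.log (2 * R)))⁻¹) 0 1
  -- Since `1 ≤ R * |r 0 0|` and `|r 0 1| ≤ R`, this leaves an off-diagonal entry larger than the
  -- bound `2 * R * |β|` imposed by commutation.
  let t := R * (R + 2 * R * |β| + 1)
  obtain ⟨γ₂, hγ₂, r, hr, hr10, hrdet, hr00, hr01, hr11⟩ := hred (uni t) (hY.right _ hy _)
  have hc := hcomm γ₁ hγ₁ γ₂ hγ₂
  rw [hq, hr] at hc
  have hc01 := congrArg (fun A : SL(2, ℝ) => A 0 1) hc.eq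
  simp only [sl2_mul _ (_ * _)] at hc01
  have e1 : (q * (dia (Real.log (2 * R)))⁻¹) 0 0 = q 0 0 * (2 * R)⁻¹ := by
    rw [dia_inv, sl2_mul]
    simp [dia, Real.exp_neg, Real.exp_log (show 0 < 2 * R by linarith)]
  have e2 : (q * (dia (Real.log (2 * R)))⁻¹) 1 1 = q 1 1 * (2 * R) := by
    rw [dia_inv, sl2_mul]
    simp [dia, Real.exp_log (show 0 < 2 * R by linarith)]
  have e3 : (r * (uni t)⁻¹) 0 0 = r 0 0 := by rw [uni_inv, sl2_mul]; simp [uni]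
  have e4 : (r * (uni t)⁻¹) 1 1 = r 1 1 := by rw [uni_inv, sl2_mul]; simp [uni, hr10]
  have e5 : (r * (uni t)⁻¹) 0 1 = r 0 1 - t * r 0 0 := by
    rw [uni_inv, sl2_mul]; simp [uni]; ring
  rw [e1, e2, e3, e4, e5] at hc01
  change _ * _ + β * _ = _ * β + _ at hc01
  have hlow : ∀ a d : ℝ, a * d = 1 → |a| ≤ R → 1 ≤ R * |d| := by
    intro a d had ha
    have : |a| * |d| = 1 := by rw [← abs_mul, had, abs_one]
    nlinarith [abs_nonneg d]
  have hd := hlow _ _ hqdet hq00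
  have ha := hlow _ _ (mul_comm (r 0 0) _ ▸ hrdet) hr11
  set m := r 0 1 - t * r 0 0
  have key : m * (q 1 1 * (2 * R) - q 0 0 * (2 * R)⁻¹) = β * (r 1 1 - r 0 0) := by
    linear_combination -hc01
  have hgap : 1 ≤ |q 1 1 * (2 * R) - q 0 0 * (2 * R)⁻¹| := by
    have h1 : 2 ≤ |q 1 1 * (2 * R)| := by
      rw [abs_mul, abs_of_pos (show 0 < 2 * R by linarith)]
      linarith
    have h2 : |q 0 0 * (2 * R)⁻¹| ≤ 1 := by
      rw [abs_mul, abs_of_pos (show 0 < (2 * R)⁻¹ by positivity), ← div_eq_mul_inv,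
        div_le_one (by linarith)]
      linarith
    linarith [abs_sub_abs_le_abs_sub (q 1 1 * (2 * R)) (q 0 0 * (2 * R)⁻¹)]
  have hm1 : |m| ≤ |β| * (2 * R) := by
    have h1 : |m| * |q 1 1 * (2 * R) - q 0 0 * (2 * R)⁻¹| = |β| * |r 1 1 - r 0 0| := by
      rw [← abs_mul, ← abs_mul, key]
    have h2 : |r 1 1 - r 0 0| ≤ 2 * R := (abs_sub _ _).trans (by linarith)
    calc |m| ≤ |m| * |q 1 1 * (2 * R) - q 0 0 * (2 * R)⁻¹| :=
          le_mul_of_one_le_right (abs_nonneg _) hgap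
      _ = |β| * |r 1 1 - r 0 0| := h1
      _ ≤ _ := mul_le_mul_of_nonneg_left h2 (abs_nonneg _)
  have hm2 : R + 2 * R * |β| + 1 - R ≤ |m| := by
    have h1 : |t * r 0 0| - |r 0 1| ≤ |m| := by
      rw [abs_sub_comm]
      exact abs_sub_abs_le_abs_sub _ _
    have h2 : R + 2 * R * |β| + 1 ≤ |t * r 0 0| := by
      have hpos : 0 ≤ R + 2 * R * |β| + 1 := by positivity
      rw [abs_mul, abs_of_nonneg (mul_nonneg hR0.le hpos)]
      nlinarith
    linarith
  linarith

/-- Hedlund's theorem: the horocycle flow of a cocompact discrete group is minimal. -/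
theorem IsUniform.horo_eq_univ (h : IsUniform Γ K) (hneg : -1 ∈ Γ) {T : Set SL(2, ℝ)}
    (hT : IsHoro Γ T) : T = Set.univ := by
  obtain ⟨Y, hYT, hYmin⟩ := hT.exists_minimal h
  have hY := hYmin.prop
  have hdia : ∀ s, ∀ z ∈ Y, z * dia s ∈ Y := h.dia_invariant hYmin
  refine Set.eq_univ_of_forall fun g => hYT ?_
  obtain ⟨γ, hγ, k, hk⟩ := h.exists_tendsto (hyperfilter ℕ) fun n => g * dia n
  obtain ⟨y, hy, hpos⟩ : ∃ y ∈ Y, 0 < (k⁻¹ * y) 0 0 := by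
    obtain ⟨y, hy, hne⟩ : ∃ y ∈ Y, (k⁻¹ * y) 0 0 ≠ 0 := by
      obtain ⟨y₁, hy₁, y₂, hy₂, hne⟩ := h.exists_transverse hY hdia
      by_contra! hcon
      apply hne
      have : y₁⁻¹ * y₂ = (k⁻¹ * y₁)⁻¹ * (k⁻¹ * y₂) := by group
      rw [this, sl2_mul, sl2_inv10, sl2_inv11, hcon _ hy₁, hcon _ hy₂]
      ring
    -- Here `-1 ∈ Γ` adjusts the sign, so that the logarithm of the entry can be used.
    rcases hne.lt_or_gt with hlt | hgt
    · refine ⟨-y, by simpa using hY.left _ hneg y hy, ?_⟩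
      simpa using hlt
    · exact ⟨y, hy, hgt⟩
  let Z : ℕ → SL(2, ℝ) := fun n => (γ n * (g * dia n))⁻¹ * y
  have hZ : Tendsto Z (hyperfilter ℕ : Filter ℕ) (𝓝 (k⁻¹ * y)) := hk.inv.mul_const y
  -- Right multiplication by `b n` removes the upper triangular factor of `dia n * Z n`, leaving a
  -- lower unipotent matrix whose entry decays like `exp (-2n)`.
  let b : ℕ → SL(2, ℝ) := fun n => uni (-(Z n 0 1 / Z n 0 0)) * dia (-Real.log (Z n 0 0) - n)
  have h00 := ((continuous_entry 0 0).tendsto _).comp hZ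
  have h10 := ((continuous_entry 1 0).tendsto _).comp hZ
  have hval : ∀ᶠ n : ℕ in (hyperfilter ℕ : Filter ℕ), dia n * Z n * b n =
      sl 1 0 (Z n 1 0 / Z n 0 0 * (Real.exp (-(n : ℝ)) * Real.exp (-(n : ℝ)))) 1 (by ring) := by
    filter_upwards [h00.eventually_const_lt hpos] with n hn
    have hn : 0 < Z n 0 0 := hn
    have hdet := sl2_det (Z n)
    have e1 : Real.exp (-Real.log (Z n 0 0) - n) = (Z n 0 0)⁻¹ * Real.exp (-(n : ℝ)) := by
      rw [sub_eq_add_neg, Real.exp_add, Real.exp_neg, Real.exp_log hn]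
    have e2 : Real.exp (-(-Real.log (Z n 0 0) - n)) = Z n 0 0 * Real.exp n := by
      rw [neg_sub, sub_neg_eq_add, add_comm, Real.exp_add, Real.exp_log hn]
    have e3 : Real.exp n * Real.exp (-(n : ℝ)) = 1 := by rw [← Real.exp_add]; simp
    apply sl2_ext <;>
      simp only [b, sl2_mul, uni, dia, sl_00, sl_01, sl_10, sl_11, e1, e2]
    · field_simp
      linear_combination Z n 0 0 * e3
    · field_simp
      ring
    · field_simp
      ring
    · rw [div_eq_mul_inv]
      linear_combination Real.exp n * Real.exp (-(n : ℝ)) * hdet + e3 -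
        Real.exp n * Real.exp (-(n : ℝ)) * Z n 1 0 * Z n 0 1 * mul_inv_cancel₀ hn.ne'
  have hexp : Tendsto (fun n : ℕ => Real.exp (-(n : ℝ))) (hyperfilter ℕ : Filter ℕ) (𝓝 0) :=
    (Real.tendsto_exp_neg_atTop_nhds_zero.comp tendsto_natCast_atTop_atTop).mono_left
      Nat.hyperfilter_le_atTop
  have hlim : Tendsto (fun n : ℕ => dia n * Z n * b n) (hyperfilter ℕ : Filter ℕ) (𝓝 1) := by
    refine Tendsto.congr' (EventuallyEq.symm hval) ?_
    apply tendsto_sl2 <;> simp only [sl_00, sl_01, sl_10, sl_11, one_00, one_01, one_10, one_11]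
    · exact tendsto_const_nhds
    · exact tendsto_const_nhds
    · simpa using (h10.div h00 hpos.ne').mul (hexp.mul hexp)
    · exact tendsto_const_nhds
  have hlim' := hlim.const_mul g
  rw [mul_one] at hlim'
  refine hY.closed.mem_of_tendsto hlim' (Eventually.of_forall fun n => ?_)
  have := hdia (-Real.log (Z n 0 0) - n) _ (hY.right _ (hY.left _ (Γ.inv_mem (hγ n)) y hy)
    (-(Z n 0 1 / Z n 0 0)))
  convert this using 1
  simp only [Z, b]
  group

end Horocycle

end

noncomputable section

namespace Horocycle

open Filter Topology

/-! ### Passage to `PSL(2, ℝ)`, the boundary, and the space `X Γ`. -/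

/-- The class in `PSL(2, ℝ)` of an element of `SL(2, ℝ)`. -/
def proj : SL(2, ℝ) →* PSL(2, ℝ) := QuotientGroup.mk' _

lemma isOpenQuotientMap_proj : IsOpenQuotientMap proj :=
  MulAction.isOpenQuotientMap_quotientMk

lemma proj_eq_pm (A : SL(2, ℝ)) :
    proj A = pm (A 0 0) (A 0 1) (A 1 0) (A 1 1) (sl2_det A) :=
  congrArg proj (sl2_ext rfl rfl rfl rfl)

lemma proj_smul_infty (A : SL(2, ℝ)) :
    proj A • (OnePoint.infty : Bdry) = ratio (A 0 0) (A 1 0) := by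
  rw [proj_eq_pm, pm_smul_infty]

lemma proj_uni_smul_infty (t : ℝ) : proj (uni t) • (OnePoint.infty : Bdry) = OnePoint.infty := by
  simp [proj_smul_infty, uni, ratio]

lemma proj_uni_mem_U (t : ℝ) : proj (uni t) ∈ U := ⟨t, rfl⟩

lemma U_le_B : U ≤ B := by
  rintro _ ⟨t, rfl⟩
  exact ⟨t, 1, one_pos, by congr 1; simp⟩

lemma smul_infty_of_mem_B {f : PSL(2, ℝ)} (hf : f ∈ B) :
    f • (OnePoint.infty : Bdry) = OnePoint.infty := by
  obtain ⟨t, l, hl, rfl⟩ := hf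
  simp [pm_smul_infty, ratio]

lemma tendsto_ratio {ι : Type*} {F : Filter ι} {a c : ι → ℝ} {a₀ c₀ : ℝ}
    (ha : Tendsto a F (𝓝 a₀)) (hc : Tendsto c F (𝓝 c₀)) (h : c₀ = 0 → a₀ ≠ 0) :
    Tendsto (fun i => ratio (a i) (c i)) F (𝓝 (ratio a₀ c₀)) := by
  by_cases hc₀ : c₀ = 0
  · subst hc₀
    rw [ratio, if_pos rfl, OnePoint.hasBasis_nhds_infty.tendsto_right_iff]
    rintro s ⟨-, hs⟩
    obtain ⟨R, hR⟩ := hs.isBounded.exists_norm_le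
    have h1 : Tendsto (fun i => R * |c i|) F (𝓝 0) := by simpa using hc.abs.const_mul R
    filter_upwards [h1.eventually_lt ha.abs (abs_pos.2 (h rfl))] with i hi
    by_cases hci : c i = 0
    · simp [ratio, hci]
    · rw [ratio, if_neg hci]
      refine Or.inl ⟨_, fun hmem => hi.not_ge ?_, rfl⟩
      have := hR _ hmem
      rwa [Real.norm_eq_abs, abs_div, div_le_iff₀ (abs_pos.2 hci)] at this
  · rw [ratio, if_neg hc₀]
    refine ((OnePoint.continuous_coe.tendsto _).comp (ha.div hc hc₀)).congr' ?_
    filter_upwards [hc.eventually_ne hc₀] with i hi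
    simp [ratio, hi]

lemma ratio_mul_right (a c : ℝ) {r : ℝ} (hr : r ≠ 0) : ratio (a * r) (c * r) = ratio a c := by
  simp only [ratio, mul_eq_zero, hr, or_false, mul_div_mul_right _ _ hr]

lemma entry_ne_zero (A : SL(2, ℝ)) (h : A 1 0 = 0) : A 0 0 ≠ 0 := fun h' => by
  have := sl2_det A
  simp [h, h'] at this

lemma continuous_smul_infty :
    Continuous fun f : PSL(2, ℝ) => f • (OnePoint.infty : Bdry) := by
  rw [← isOpenQuotientMap_proj.continuous_comp_iff]
  refine continuous_iff_continuousAt.2 fun A => ?_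
  have := tendsto_ratio ((continuous_entry 0 0).tendsto A) ((continuous_entry 1 0).tendsto A)
    (entry_ne_zero A)
  simpa only [ContinuousAt, Function.comp_def, proj_smul_infty] using this

lemma proj_eq_one {A : SL(2, ℝ)} (h : proj A = 1) (hpos : 0 < A 0 0) : A = 1 := by
  have hc : A ∈ Subgroup.center SL(2, ℝ) := (QuotientGroup.eq_one_iff A).1 h
  obtain ⟨r, hr, hA⟩ := Matrix.SpecialLinearGroup.mem_center_iff.1 hc
  have h00 : A 0 0 = r := by simp [← hA]
  have hr1 : r = 1 := by
    rw [h00] at hpos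
    simp only [Fintype.card_fin] at hr
    nlinarith
  refine Subtype.ext ?_
  rw [← hA, hr1]
  simp

lemma proj_neg_one : proj (-1) = 1 := by
  refine (QuotientGroup.eq_one_iff _).2 (Matrix.SpecialLinearGroup.mem_center_iff.2 ⟨-1, ?_, ?_⟩)
  · simp
  · rw [map_neg, map_one]
    simp

/-- Images of finitely many compact neighbourhoods cover the compact quotient; their union is `K`.
-/
lemma exists_isUniform (Γ : Subgroup PSL(2, ℝ)) (discrete : DiscreteTopology Γ)
    (cocompact : CompactSpace (Quotient (MulAction.orbitRel Γ PSL(2, ℝ)))) :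
    ∃ K, IsUniform (Γ.comap proj) K := by
  let q : SL(2, ℝ) → Quotient (MulAction.orbitRel Γ PSL(2, ℝ)) := fun A => Quotient.mk _ (proj A)
  have hq : IsOpenQuotientMap q :=
    (MulAction.isOpenQuotientMap_quotientMk (Γ := Γ)).comp isOpenQuotientMap_proj
  have : LocallyCompactSpace (Matrix (Fin 2) (Fin 2) ℝ) :=
    inferInstanceAs (LocallyCompactSpace (Fin 2 → Fin 2 → ℝ))
  have : LocallyCompactSpace SL(2, ℝ) :=
    Matrix.SpecialLinearGroup.isClosedEmbedding_val.locallyCompactSpace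
  choose C hC hCx using fun A : SL(2, ℝ) => exists_compact_mem_nhds A
  choose s hs using hq.surjective
  obtain ⟨t, -, ht⟩ := isCompact_univ.elim_nhds_subcover (fun x => q '' C (s x)) fun x _ => by
    have := hq.isOpenMap.image_mem_nhds (hCx (s x))
    rwa [hs] at this
  refine ⟨⋃ x ∈ t, C (s x), t.isCompact_biUnion fun x _ => hC _, fun g => ?_, ?_⟩
  · obtain ⟨x, hx, A, hA, hAg⟩ : ∃ x ∈ t, ∃ A ∈ C (s x), q A = q g := by
      simpa using ht (Set.mem_univ (q g))
    obtain ⟨γ, hγ⟩ : ∃ γ : Γ, γ • proj g = proj A := Quotient.exact hAg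
    have hγ' : (γ : PSL(2, ℝ)) = proj (A * g⁻¹) := by
      rw [map_mul, map_inv, ← hγ]
      simp [Subgroup.smul_def]
    refine ⟨A * g⁻¹, ?_, ?_⟩
    · rw [Subgroup.mem_comap, ← hγ']
      exact γ.2
    · rw [inv_mul_cancel_right]
      exact Set.mem_biUnion hx hA
  · obtain ⟨W, hW, hW1⟩ := isOpen_induced_iff.1 (isOpen_discrete ({1} : Set Γ))
    have h1 : (1 : PSL(2, ℝ)) ∈ W := by
      have : (1 : Γ) ∈ ((↑) : Γ → PSL(2, ℝ)) ⁻¹' W := by rw [hW1]; rfl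
      exact this
    have e1 : ∀ᶠ g in 𝓝 (1 : SL(2, ℝ)), proj g ∈ W :=
      isOpenQuotientMap_proj.continuous.continuousAt.eventually_mem
        (hW.mem_nhds (by rwa [map_one]))
    -- This excludes `-1`, the other element of the kernel of `proj`.
    have e2 : ∀ᶠ g in 𝓝 (1 : SL(2, ℝ)), 0 < g 0 0 :=
      ((continuous_entry 0 0).tendsto 1).eventually_const_lt (by simp)
    filter_upwards [e1, e2] with g hgW hg hgΓ
    refine proj_eq_one ?_ hg
    have : (⟨proj g, hgΓ⟩ : Γ) ∈ ((↑) : Γ → PSL(2, ℝ)) ⁻¹' W := hgW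
    rw [hW1] at this
    exact congrArg Subtype.val this

variable (Γ : Subgroup PSL(2, ℝ))

lemma toX_smul {γ : PSL(2, ℝ)} (hγ : γ ∈ Γ) (f : PSL(2, ℝ)) (ξ : Bdry) :
    toX Γ (γ * f) (γ • ξ) = toX Γ f ξ :=
  Quotient.sound ⟨⟨γ, hγ⟩, rfl⟩

lemma mem_M_iff (x : X Γ) :
    x ∈ M Γ ↔ ∃ f : PSL(2, ℝ), x = toX Γ f (f • (OnePoint.infty : Bdry)) := by
  constructor
  · rintro ⟨a, b, c, d, h, rfl⟩
    exact ⟨pm a b c d h, by rw [pm_smul_infty]⟩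
  · rintro ⟨f, rfl⟩
    obtain ⟨A, rfl⟩ := isOpenQuotientMap_proj.surjective f
    exact ⟨_, _, _, _, sl2_det A, by rw [← proj_eq_pm, proj_smul_infty]⟩

/-- The relation `ξ = f • ∞` is `Γ`-equivariant, so it does not depend on the representative. -/
lemma toX_mem_M_iff (f : PSL(2, ℝ)) (ξ : Bdry) :
    toX Γ f ξ ∈ M Γ ↔ ξ = f • (OnePoint.infty : Bdry) := by
  rw [mem_M_iff]
  constructor
  · rintro ⟨g, hg⟩
    obtain ⟨γ, hγ⟩ := Quotient.exact hg
    obtain ⟨rfl, rfl⟩ := Prod.ext_iff.1 hγ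
    exact (mul_smul (γ : PSL(2, ℝ)) g _).symm
  · rintro rfl
    exact ⟨f, rfl⟩

lemma continuous_toX : Continuous fun p : PSL(2, ℝ) × Bdry => toX Γ p.1 p.2 :=
  continuous_quot_mk

lemma isClosed_M : IsClosed (M Γ) := by
  refine (isQuotientMap_quot_mk (X := PSL(2, ℝ) × Bdry)).isClosed_preimage.1 ?_
  have : IsClosed {p : PSL(2, ℝ) × Bdry | p.2 = p.1 • (OnePoint.infty : Bdry)} :=
    isClosed_eq continuous_snd (continuous_smul_infty.comp continuous_fst)
  convert this using 1
  ext p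
  exact toX_mem_M_iff Γ p.1 p.2

lemma nonempty_M : (M Γ).Nonempty := ⟨_, (mem_M_iff Γ _).2 ⟨1, rfl⟩⟩

lemma rightMul_mem_M {x : X Γ} (hx : x ∈ M Γ) {f : PSL(2, ℝ)} (hf : f ∈ B) :
    rightMul Γ x f ∈ M Γ := by
  obtain ⟨g, rfl⟩ := (mem_M_iff Γ _).1 hx
  rw [rightMul_toX, toX_mem_M_iff, mul_smul, smul_infty_of_mem_B hf]

variable {Γ}

/-- Every horocycle orbit closure in `X` meets `M`. -/
lemma exists_toX_mem {K : Set SL(2, ℝ)} (h : IsUniform (Γ.comap proj) K) {T : Set (X Γ)}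
    (hne : T.Nonempty) (hT : IsClosed T) (hU : ∀ x ∈ T, ∀ f ∈ U, rightMul Γ x f ∈ T) :
    ∃ A : SL(2, ℝ), toX Γ (proj A) (proj A • (OnePoint.infty : Bdry)) ∈ T := by
  obtain ⟨x, hx⟩ := hne
  obtain ⟨⟨f, ξ⟩, rfl⟩ := Quotient.exists_rep x
  obtain ⟨A, rfl⟩ := isOpenQuotientMap_proj.surjective f
  change toX Γ (proj A) ξ ∈ T at hx
  obtain ⟨η, rfl⟩ : ∃ η, ξ = proj A • η := ⟨(proj A)⁻¹ • ξ, by simp⟩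
  induction η using OnePoint.rec with
  | infty => exact ⟨A, hx⟩
  | coe x =>
    obtain ⟨γ, hγ, k, hk⟩ := h.exists_tendsto (hyperfilter ℕ) fun n => A * uni n
    refine ⟨k, ?_⟩
    let k' : ℕ → SL(2, ℝ) := fun n => γ n * (A * uni n)
    have hmem : ∀ n : ℕ,
        toX Γ (proj (k' n)) (proj (k' n) • (((x - n : ℝ) : OnePoint ℝ) : Bdry)) ∈ T := by
      intro n
      have hn := hU _ hx _ (proj_uni_mem_U n)
      rw [rightMul_toX, ← map_mul, ← toX_smul Γ (hγ n), ← map_mul, smul_smul, ← map_mul] at hn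
      have e : proj (uni n) • (((x - n : ℝ) : OnePoint ℝ) : Bdry) = (x : OnePoint ℝ) := by
        simp [proj_eq_pm, pm_smul_coe, uni, ratio]
      rwa [← e, smul_smul, ← map_mul, mul_assoc] at hn
    have hinv : Tendsto (fun n : ℕ => (x - (n : ℝ))⁻¹) (hyperfilter ℕ : Filter ℕ) (𝓝 0) := by
      refine Tendsto.mono_left ?_ Nat.hyperfilter_le_atTop
      exact tendsto_inv_atBot_zero.comp
        (tendsto_atBot_add_const_left _ x (tendsto_neg_atTop_atBot.comp tendsto_natCast_atTop_atTop))
    have hent : ∀ i j, Tendsto (fun n => k' n i j) (hyperfilter ℕ : Filter ℕ) (𝓝 (k i j)) :=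
      fun i j => ((continuous_entry i j).tendsto k).comp hk
    have hlim : Tendsto (fun n : ℕ => proj (k' n) • (((x - n : ℝ) : OnePoint ℝ) : Bdry))
        (hyperfilter ℕ : Filter ℕ) (𝓝 (proj k • (OnePoint.infty : Bdry))) := by
      -- Homogeneous coordinates of the image of `x - n` are divided by `x - n` to get a finite
      -- nonzero limit.
      have h0 := (hent 0 0).add ((hent 0 1).mul hinv)
      have h1 := (hent 1 0).add ((hent 1 1).mul hinv)
      rw [mul_zero, add_zero] at h0 h1
      rw [proj_smul_infty]
      refine (tendsto_ratio h0 h1 (entry_ne_zero k)).congr' ?_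
      have hne : ∀ᶠ n : ℕ in (hyperfilter ℕ : Filter ℕ), x < n :=
        (tendsto_natCast_atTop_atTop.eventually_gt_atTop x).filter_mono Nat.hyperfilter_le_atTop
      filter_upwards [hne] with n hn
      have hxn : x - n ≠ 0 := (sub_neg.2 hn).ne
      rw [proj_eq_pm, pm_smul_coe, ← ratio_mul_right _ _ hxn, add_mul, add_mul, mul_assoc,
        mul_assoc, inv_mul_cancel₀ hxn, mul_one, mul_one]
    exact hT.mem_of_tendsto (((continuous_toX Γ).tendsto _).comp
      (((isOpenQuotientMap_proj.continuous.tendsto k).comp hk).prodMk_nhds hlim))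
      (Eventually.of_forall hmem)

/-- A non-empty closed horocycle-invariant subset of `X` contains `M`. -/
lemma M_subset {K : Set SL(2, ℝ)} (h : IsUniform (Γ.comap proj) K) {T : Set (X Γ)}
    (hne : T.Nonempty) (hT : IsClosed T) (hU : ∀ x ∈ T, ∀ f ∈ U, rightMul Γ x f ∈ T) :
    M Γ ⊆ T := by
  have hhoro : IsHoro (Γ.comap proj)
      {A : SL(2, ℝ) | toX Γ (proj A) (proj A • (OnePoint.infty : Bdry)) ∈ T} := by
    refine ⟨exists_toX_mem h hne hT hU, ?_, fun γ hγ A hA => ?_, fun A hA t => ?_⟩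
    · have hp := isOpenQuotientMap_proj.continuous
      exact hT.preimage ((continuous_toX Γ).comp (hp.prodMk (continuous_smul_infty.comp hp)))
    · rw [Set.mem_ofPred_eq, map_mul, mul_smul, toX_smul Γ hγ]
      exact hA
    · rw [Set.mem_ofPred_eq, map_mul, mul_smul, proj_uni_smul_infty, ← rightMul_toX]
      exact hU _ hA _ (proj_uni_mem_U t)
  have huniv := h.horo_eq_univ (by rw [Subgroup.mem_comap, proj_neg_one]; exact Γ.one_mem) hhoro
  intro x hx
  obtain ⟨f, rfl⟩ := (mem_M_iff Γ x).1 hx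
  obtain ⟨A, rfl⟩ := isOpenQuotientMap_proj.surjective f
  exact huniv.ge (Set.mem_univ A)

lemma isMinimalSet_M_and_unique {K : Set SL(2, ℝ)} (h : IsUniform (Γ.comap proj) K)
    {F : Subgroup PSL(2, ℝ)} (hUF : U ≤ F) (hFB : F ≤ B) :
    IsMinimalSet Γ F (M Γ) ∧ ∀ S : Set (X Γ), IsMinimalSet Γ F S → S = M Γ := by
  have hsub : ∀ T : Set (X Γ), (T.Nonempty ∧ IsClosed T ∧ ∀ x ∈ T, ∀ f ∈ F, rightMul Γ x f ∈ T) →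
      M Γ ⊆ T := fun T hT => M_subset h hT.1 hT.2.1 fun x hx f hf => hT.2.2 x hx f (hUF hf)
  have hM : (M Γ).Nonempty ∧ IsClosed (M Γ) ∧ ∀ x ∈ M Γ, ∀ f ∈ F, rightMul Γ x f ∈ M Γ :=
    ⟨nonempty_M Γ, isClosed_M Γ, fun x hx f hf => rightMul_mem_M Γ hx (hFB hf)⟩
  exact ⟨⟨hM, fun T hT _ => hsub T hT⟩,
    fun S hS => (hS.le_of_le hM (hsub S hS.prop)).antisymm (hsub S hS.prop)⟩

end Horocycle

end

theorem proposition4p1 (Γ : Subgroup PSL(2, ℝ))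
    (discrete : DiscreteTopology Γ)
    (torsion_free : ∀ γ ∈ Γ, IsOfFinOrder γ → γ = 1)
    (cocompact : CompactSpace (Quotient (MulAction.orbitRel Γ PSL(2, ℝ)))) :
    (Horocycle.IsMinimalSet Γ Horocycle.B (Horocycle.M Γ) ∧
      ∀ S : Set (Horocycle.X Γ), Horocycle.IsMinimalSet Γ Horocycle.B S → S = Horocycle.M Γ) ∧
    (Horocycle.IsMinimalSet Γ Horocycle.U (Horocycle.M Γ) ∧
      ∀ S : Set (Horocycle.X Γ), Horocycle.IsMinimalSet Γ Horocycle.U S → S = Horocycle.M Γ) := by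
  obtain ⟨K, hK⟩ := Horocycle.exists_isUniform Γ discrete cocompact
  exact ⟨Horocycle.isMinimalSet_M_and_unique hK Horocycle.U_le_B le_rfl,
    Horocycle.isMinimalSet_M_and_unique hK le_rfl Horocycle.U_le_B⟩
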